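/- Let $\mathcal K,\mathcal G$ be real Hilbert spaces. Let $B\colon\mathcal K\to 2^{\mathcal K}$ and $D\colon\mathcal G\to 2^{\mathcal G}$ be maximally monotone, let $E\colon\mathcal K\to\mathcal K$ be monotone and $\delta$-Lipschitz continuous ($\delta\ge 0$), let $F\colon\mathcal K\to\mathcal K$ be $\beta^{-1}$-cocoercive for some $\beta>0$, that is $\langle Fx-Fy,x-y\rangle\ge\beta^{-1}\|Fx-Fy\|^2$ for all $x,y\in\mathcal K$ (if $F=0$, then $\beta=0$ is also allowed), and let $V\colon\mathcal K\to\mathcal G$ be linear and bounded. Assume that the primal problem of finding $y\in\mathcal K$ with $$0\in By+(V^*\circ D\circ V)y+Ey+Fy \tag{P}$$ has a solution, and consider also the primal-dual problem of finding $(y,z)\in\mathcal K\times\mathcal G$ with $$0\in By+V^*z+Ey+Fy,\qquad 0\in D^{-1}z-Vy. \tag{PD}$$ Let $\tau,\sigma>0$, let $\lambda_k\in\mathbb R$ for $k\in\{-1,0,1,\dots\}$, and let $y_{-1},y_0\in\mathcal K$ and $z_0\in\mathcal G$ be arbitrary. Consider the iteration, for $k=0,1,2,\dots$, $$\begin{aligned}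 y_{k+1}&=(\mathrm{Id}+\tau B)^{-1}\bigl(y_k-\tau V^*z_k-\tau(2Ey_k-Ey_{k-1})-\tau Fy_k\bigr),\\ v_{k+1}&=\lambda_k(y_{k+1}-y_k)+(2-\lambda_{k-1})(y_k-y_{k-1}),\\ z_{k+1}&=(\mathrm{Id}+\sigma D^{-1})^{-1}\bigl(z_k+\sigma V(y_k+v_{k+1})\bigr). \end{aligned}$$ Suppose that there exists $\epsilon>0$ such that, for all $k\in\{0,1,2,\dots\}$, $$\tau\sigma\|V\|^2+\bigl(|2-\lambda_k|+|2-\lambda_{k+1}|\bigr)\sqrt{\tau\sigma}\,\|V\|+\tau\bigl(2\delta+\tfrac12\beta\bigr)<1-\epsilon .$$ Then the iteration determines unique infinite sequences $(y_k)$ and $(z_k)$, and there exist $y^\star\in\mathcal K$ and $z^\star\in\mathcal G$ such that $y_k\rightharpoonup y^\star$ and $z_k\rightharpoonup z^\star$ weakly as $k\to\infty$, $y^\star$ is a solution of (P), and $(y^\star,z^\star)$ is a solution of (PD). -/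

import Mathlib

open Filter Topology
open scoped Pointwise NNReal

/-- A set-valued operator `A : H → 2^H` is monotone. A single-valued operator `E : H → H`
is regarded as the set-valued operator `x ↦ {E x}`. -/
def IsMonotoneOperator {H : Type*} [NormedAddCommGroup H] [InnerProductSpace ℝ H]
    (A : H → Set H) : Prop :=
  ∀ x y u v : H, u ∈ A x → v ∈ A y → 0 ≤ inner ℝ (u - v) (x - y)

/-- `A` is maximally monotone: it is monotone and its graph is not a proper subset of the graph
of another monotone operator. -/
def IsMaximallyMonotone {H : Type*} [NormedAddCommGroup H] [InnerProductSpace ℝ H]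
    (A : H → Set H) : Prop :=
  IsMonotoneOperator A ∧
    ∀ A' : H → Set H, IsMonotoneOperator A' → (∀ x, A x ⊆ A' x) → A' = A

/-- `F : H → H` is `β⁻¹`-cocoercive, where `β > 0`. -/
def IsCocoerciveInv {H : Type*} [NormedAddCommGroup H] [InnerProductSpace ℝ H]
    (β : ℝ) (F : H → H) : Prop :=
  0 < β ∧ ∀ x y : H, β⁻¹ * ‖F x - F y‖ ^ 2 ≤ inner ℝ (F x - F y) (x - y)

/-- The inverse `A⁻¹` of a set-valued operator: `x ∈ A⁻¹ u` iff `u ∈ A x`. -/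
def opInverse {X Y : Type*} (A : X → Set Y) (u : Y) : Set X := {x | u ∈ A x}

/-- The resolvent `(Id + τ A)⁻¹`, as a set-valued operator. -/
def opResolvent {H : Type*} [NormedAddCommGroup H] [InnerProductSpace ℝ H]
    (τ : ℝ) (A : H → Set H) : H → Set H :=
  opInverse (fun x => {x} + τ • A x)

/-- `y` solves the primal inclusion `0 ∈ B y + (V^* ∘ D ∘ V) y + E y + F y`. -/
def IsPrimalSolution {K G : Type*}
    [NormedAddCommGroup K] [InnerProductSpace ℝ K] [CompleteSpace K]
    [NormedAddCommGroup G] [InnerProductSpace ℝ G] [CompleteSpace G]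
    (B : K → Set K) (D : G → Set G) (E F : K → K) (V : K →L[ℝ] G) (y : K) : Prop :=
  (0 : K) ∈ B y + (ContinuousLinearMap.adjoint V) '' (D (V y)) + {E y} + {F y}

/-- `(y, z)` solves the primal-dual inclusion
`0 ∈ B y + V^* z + E y + F y` and `0 ∈ D⁻¹ z - V y`. -/
def IsPrimalDualSolution {K G : Type*}
    [NormedAddCommGroup K] [InnerProductSpace ℝ K] [CompleteSpace K]
    [NormedAddCommGroup G] [InnerProductSpace ℝ G] [CompleteSpace G]
    (B : K → Set K) (D : G → Set G) (E F : K → K) (V : K →L[ℝ] G) (y : K) (z : G) : Prop :=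
  (0 : K) ∈ B y + {ContinuousLinearMap.adjoint V z} + {E y} + {F y} ∧
    (0 : G) ∈ opInverse D z - {V y}

/-- For a sequence `s_{-1}, s_0, s_1, …` given by `a = s_{-1}` and `s : ℕ → X`,
`lagged a s k` is the term `s_{k-1}`. -/
def lagged {X : Type*} (a : X) (s : ℕ → X) : ℕ → X
  | 0 => a
  | k + 1 => s k

/-- The sequences `(y_k)` and `(z_k)` are generated by the primal-dual method with block-triangular
resolvent from the initial data `y_{-1}, y_0, z_0`, the step sizes `τ, σ` and the
parameters `λ_{-1}` and `λ_0, λ_1, …`. -/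
structure IsBlockTriangularPrimalDual {K G : Type*}
    [NormedAddCommGroup K] [InnerProductSpace ℝ K] [CompleteSpace K]
    [NormedAddCommGroup G] [InnerProductSpace ℝ G] [CompleteSpace G]
    (B : K → Set K) (D : G → Set G) (E F : K → K) (V : K →L[ℝ] G)
    (τ σ lamInit : ℝ) (lam : ℕ → ℝ) (yInit y₀ : K) (z₀ : G)
    (y : ℕ → K) (z : ℕ → G) : Prop where
  y_zero : y 0 = y₀
  z_zero : z 0 = z₀
  /-- The primal update. -/
  y_succ : ∀ k : ℕ, y (k + 1) ∈ opResolvent τ B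
    (y k - τ • ContinuousLinearMap.adjoint V (z k)
      - τ • ((2 : ℝ) • E (y k) - E (lagged yInit y k)) - τ • F (y k))
  /-- The dual update, with the correction
  `v_{k+1} = λ_k (y_{k+1} - y_k) + (2 - λ_{k-1}) (y_k - y_{k-1})`. -/
  z_succ : ∀ k : ℕ, z (k + 1) ∈ opResolvent σ (opInverse D)
    (z k + σ • V (y k + (lam k • (y (k + 1) - y k)
      + (2 - lagged lamInit lam k) • (y k - lagged yInit y k))))

/-- Weak convergence of a sequence: `x_k ⇀ a`. -/
def WeaklyConverges {H : Type*} [NormedAddCommGroup H] [InnerProductSpace ℝ H]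
    (x : ℕ → H) (a : H) : Prop :=
  Tendsto (fun k => toWeakSpace ℝ H (x k)) atTop (𝓝 (toWeakSpace ℝ H a))

/-! The pair (y, z) is measured in the metric of the block operator M = [[τ⁻¹, -V^*], [-V, σ⁻¹]].
Each step is then a resolvent step for B × D⁻¹ plus a monotone Lipschitz map, up to two errors: the
increments of E, and the increments V(y_{k+1} - y_k) weighted by μ_k = 2 - λ_k. Both errors
telescope. Once they are built into the energy, only products of consecutive increments and the
cocoercivity defect of F remain (`momentumEnergy_succ_le`). Young's inequality charges these to
squared increments, and the step-size condition is the budget that pays for them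
(`momentumEnergy_descent`). Hence the iterates are bounded, their increments vanish, and the
M-distance to every primal-dual solution converges (`asymptotics_of_momentumEnergy_le`).

Opial's argument finishes the proof (`exists_weak_limit_of_primalDualForm`): weak cluster points are
solutions by demiclosedness (`IsMaximallyMonotone.neg_mem_and_neg_mem_of_tendsto`), and convergence
of the distances to two cluster points forces them to coincide. Well-posedness is Minty's theorem
(`IsMaximallyMonotone.nonempty_opResolvent`), obtained by maximising a strongly concave function
over a convex hull. -/

/-! ### Resolvents and Minty's theorem. -/

section Resolvent

variable {H : Type*} [NormedAddCommGroup H] [InnerProductSpace ℝ H]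

theorem IsMaximallyMonotone.mem_of_forall {A : H → Set H} (hA : IsMaximallyMonotone A) {x u : H}
    (h : ∀ a b, b ∈ A a → 0 ≤ inner ℝ (u - b) (x - a)) : u ∈ A x := by
  have key : (fun z => A z ∪ {w | w = u ∧ z = x}) = A := by
    refine hA.2 _ ?_ fun z => Set.subset_union_left
    rintro z z' w w' (hw | ⟨rfl, rfl⟩) (hw' | ⟨rfl, rfl⟩)
    · exact hA.1 _ _ _ _ hw hw'
    · have := h _ _ hw
      rwa [← neg_sub w, ← neg_sub z, inner_neg_neg] at this
    · exact h _ _ hw'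
    · simp
  rw [← key]
  exact Or.inr ⟨rfl, rfl⟩

theorem IsMonotoneOperator.opInverse {A : H → Set H} (hA : IsMonotoneOperator A) :
    IsMonotoneOperator (opInverse A) := fun x y u v hu hv => by
  rw [real_inner_comm]
  exact hA u v x y hu hv

theorem IsMaximallyMonotone.opInverse {A : H → Set H} (hA : IsMaximallyMonotone A) :
    IsMaximallyMonotone (opInverse A) := by
  refine ⟨hA.1.opInverse, fun A' hA' hsub => ?_⟩
  have := hA.2 _ hA'.opInverse fun x u hu => hsub u hu
  rw [← this]
  rfl

theorem mem_opResolvent_iff {A : H → Set H} {τ : ℝ} {x p : H} (hτ : τ ≠ 0) :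
    p ∈ opResolvent τ A x ↔ τ⁻¹ • (x - p) ∈ A p := by
  simp only [opResolvent, _root_.opInverse, Set.mem_ofPred_eq, Set.singleton_add, Set.mem_image,
    Set.mem_smul_set]
  constructor
  · rintro ⟨_, ⟨u, hu, rfl⟩, rfl⟩
    simpa [smul_smul, hτ] using hu
  · intro h
    exact ⟨x - p, ⟨_, h, by simp [smul_smul, hτ]⟩, by abel⟩

theorem IsMonotoneOperator.norm_sub_le_of_mem_opResolvent {A : H → Set H}
    (hA : IsMonotoneOperator A) {τ : ℝ} (hτ : 0 < τ) {x x' p p' : H}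
    (hp : p ∈ opResolvent τ A x) (hp' : p' ∈ opResolvent τ A x') : ‖p - p'‖ ≤ ‖x - x'‖ := by
  rw [mem_opResolvent_iff hτ.ne'] at hp hp'
  have h := hA _ _ _ _ hp hp'
  rw [← smul_sub, real_inner_smul_left] at h
  have h1 : 0 ≤ inner ℝ (x - p - (x' - p')) (p - p') :=
    nonneg_of_mul_nonneg_right h (inv_pos.2 hτ)
  rw [show x - p - (x' - p') = (x - x') - (p - p') by abel, inner_sub_left,
    real_inner_self_eq_norm_sq] at h1
  have h2 := real_inner_le_norm (x - x') (p - p')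
  by_contra! h3
  have := norm_nonneg (x - x')
  nlinarith

/-- The convex hull of `{(a, c, ⟨a, c⟩)}` lies below the duality pairing when the set of pairs
`(a, c)` is antitone. -/
theorem le_inner_of_mem_convexHull {S : Set (H × H)}
    (hS : ∀ p ∈ S, ∀ q ∈ S, inner ℝ (p.1 - q.1) (p.2 - q.2) ≤ 0) {m : H × H × ℝ}
    (hm : m ∈ convexHull ℝ ((fun p : H × H => (p.1, p.2, inner ℝ p.1 p.2)) '' S)) :
    m.2.2 ≤ inner ℝ m.1 m.2.1 := by
  have hconv : ∀ p : H × H × ℝ, Convex ℝ {q : H × H × ℝ |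
      p.2.2 + q.2.2 - inner ℝ q.1 p.2.1 - inner ℝ p.1 q.2.1 ≤ 0} := by
    intro p x hx y hy s t hs ht hst
    simp only [Set.mem_ofPred_eq, Prod.fst_add, Prod.snd_add, Prod.smul_fst, Prod.smul_snd,
      inner_add_left, inner_add_right, real_inner_smul_left, real_inner_smul_right,
      smul_eq_mul] at *
    obtain rfl : t = 1 - s := by linarith
    nlinarith [mul_nonneg hs (neg_nonneg.2 hx), mul_nonneg ht (neg_nonneg.2 hy)]
  have hvertex : ∀ p ∈ S, ∀ q ∈ convexHull ℝ ((fun p : H × H => (p.1, p.2, inner ℝ p.1 p.2)) '' S),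
      inner ℝ p.1 p.2 + q.2.2 - inner ℝ q.1 p.2 - inner ℝ p.1 q.2.1 ≤ 0 := by
    intro p hp q hq
    refine convexHull_min ?_ (hconv (p.1, p.2, inner ℝ p.1 p.2)) hq
    rintro _ ⟨q, hq, rfl⟩
    have := hS p hp q hq
    simp only [inner_sub_left, inner_sub_right] at this
    simp only [Set.mem_ofPred_eq]
    linarith
  -- The expression is affine in each argument and nonpositive at pairs of vertices. Freeing one
  -- argument at a time reaches the pair (m, m), where it is twice the claim.
  have hdiag := convexHull_min (s := (fun p : H × H => (p.1, p.2, inner ℝ p.1 p.2)) '' S)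
    (t := _) ?_ (hconv m) hm
  · simp only [Set.mem_ofPred_eq] at hdiag
    linarith
  · rintro _ ⟨q, hq, rfl⟩
    have := hvertex q hq m hm
    simp only [Set.mem_ofPred_eq]
    linarith

/-- An upper bounded functional `(m, r) ↦ r - ‖m‖²` on a nonempty convex set `P` has a generalised
maximiser `x`, which satisfies the first-order optimality condition. -/
theorem exists_forall_add_norm_sub_sq_le [CompleteSpace H] {P : Set (H × ℝ)} (hP : Convex ℝ P)
    (hne : P.Nonempty) (hle : ∀ p ∈ P, p.2 ≤ ‖p.1‖ ^ 2) :
    ∃ x : H, ∀ p ∈ P, p.2 - ‖p.1‖ ^ 2 + ‖x - p.1‖ ^ 2 ≤ 0 := by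
  set g : H × ℝ → ℝ := fun p => p.2 - ‖p.1‖ ^ 2 with hg
  -- This identity is strong concavity of `g` in the first component: midpoints of near-maximisers
  -- make that component Cauchy.
  have hcomb : ∀ p q : H × ℝ, ∀ s : ℝ, g ((1 - s) • p + s • q)
      = (1 - s) * g p + s * g q + s * (1 - s) * ‖p.1 - q.1‖ ^ 2 := by
    intro p q s
    simp only [hg, Prod.fst_add, Prod.snd_add, Prod.smul_fst, Prod.smul_snd, smul_eq_mul,
      ← real_inner_self_eq_norm_sq, inner_add_left, inner_add_right, inner_sub_left,
      inner_sub_right, real_inner_smul_left, real_inner_smul_right, real_inner_comm p.1 q.1]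
    ring
  have hbdd : BddAbove (g '' P) := ⟨0, by
    rintro _ ⟨p, hp, rfl⟩
    simpa [hg] using hle p hp⟩
  set M := sSup (g '' P) with hM
  have hgM : ∀ p ∈ P, g p ≤ M := fun p hp => le_csSup hbdd ⟨p, hp, rfl⟩
  have hM0 : M ≤ 0 := csSup_le (hne.image g) (by
    rintro _ ⟨p, hp, rfl⟩
    simpa [hg] using hle p hp)
  have hex : ∀ n : ℕ, ∃ p ∈ P, M - 1 / ((n : ℝ) + 1) < g p := by
    intro n
    obtain ⟨_, ⟨p, hp, rfl⟩, h⟩ := exists_lt_of_lt_csSup (hne.image g)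
      (show M - 1 / ((n : ℝ) + 1) < sSup (g '' P) from sub_lt_self _ (by positivity))
    exact ⟨p, hp, h⟩
  choose m hmP hm using hex
  have hlim0 : Tendsto (fun n : ℕ => 1 / ((n : ℝ) + 1)) atTop (𝓝 0) :=
    tendsto_one_div_add_atTop_nhds_zero_nat
  have hcauchy : CauchySeq fun n => (m n).1 := by
    rw [Metric.cauchySeq_iff]
    intro ε hε
    have hev : ∀ᶠ n : ℕ in atTop, 1 / ((n : ℝ) + 1) < ε ^ 2 / 8 :=
      hlim0.eventually_lt_const (by positivity)
    obtain ⟨N, hN⟩ := eventually_atTop.1 hev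
    refine ⟨N, fun i hi j hj => ?_⟩
    have h1 := hgM _ (hP (hmP i) (hmP j) (a := 1 - 1 / 2) (b := 1 / 2) (by norm_num) (by norm_num)
      (by norm_num))
    rw [hcomb] at h1
    have h2 := hm i
    have h3 := hm j
    have h4 := hN i hi
    have h5 := hN j hj
    rw [dist_eq_norm]
    refine lt_of_pow_lt_pow_left₀ 2 hε.le ?_
    nlinarith
  obtain ⟨x, hx⟩ := cauchySeq_tendsto_of_complete hcauchy
  refine ⟨x, fun p hp => ?_⟩
  -- The supremum need not be attained, so optimality is tested on segments from the maximising
  -- sequence towards `p`: first n → ∞, then division by `s`, and finally s → 0.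
  have key : ∀ s : ℝ, 0 < s → s < 1 → g p + (1 - s) * ‖x - p.1‖ ^ 2 ≤ M := by
    intro s hs hs1
    have hl : Tendsto (fun n : ℕ => (1 - s) * (M - 1 / ((n : ℝ) + 1)) + s * g p
        + s * (1 - s) * ‖(m n).1 - p.1‖ ^ 2) atTop
        (𝓝 ((1 - s) * (M - 0) + s * g p + s * (1 - s) * ‖x - p.1‖ ^ 2)) :=
      (((tendsto_const_nhds.sub hlim0).const_mul _).add_const _).add
        (((hx.sub_const _).norm.pow 2).const_mul _)
    have h1 : (1 - s) * (M - 0) + s * g p + s * (1 - s) * ‖x - p.1‖ ^ 2 ≤ M := by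
      refine le_of_tendsto hl (Eventually.of_forall fun n => ?_)
      have h2 := hgM _ (hP (hmP n) hp (a := 1 - s) (b := s) (by linarith) hs.le (by ring))
      rw [hcomb] at h2
      nlinarith [mul_le_mul_of_nonneg_left (hm n).le (by linarith : (0 : ℝ) ≤ 1 - s)]
    nlinarith
  have hl : Tendsto (fun s : ℝ => g p + (1 - s) * ‖x - p.1‖ ^ 2) (𝓝[>] 0)
      (𝓝 (g p + (1 - 0) * ‖x - p.1‖ ^ 2)) := by
    refine Tendsto.mono_left ?_ nhdsWithin_le_nhds
    exact Continuous.tendsto (by fun_prop) 0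
  have := le_of_tendsto hl (by
    filter_upwards [Ioo_mem_nhdsGT (zero_lt_one (α := ℝ))] with s hs using key s hs.1 hs.2)
  simp only [hg] at this
  linarith

/-- **Minty's theorem**: the resolvent of a maximally monotone operator is defined everywhere. -/
theorem IsMaximallyMonotone.nonempty_opResolvent [CompleteSpace H] {A : H → Set H}
    (hA : IsMaximallyMonotone A) {τ : ℝ} (hτ : 0 < τ) (x : H) : (opResolvent τ A x).Nonempty := by
  set S : Set (H × H) := {p | τ⁻¹ • (x - p.2) ∈ A p.1} with hS
  have hanti : ∀ p ∈ S, ∀ q ∈ S, inner ℝ (p.1 - q.1) (p.2 - q.2) ≤ 0 := by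
    intro p hp q hq
    have h := hA.1 _ _ _ _ hp hq
    rw [← smul_sub, real_inner_smul_left] at h
    have h1 := nonneg_of_mul_nonneg_right h (inv_pos.2 hτ)
    rw [show x - p.2 - (x - q.2) = -(p.2 - q.2) by abel, inner_neg_left, real_inner_comm] at h1
    linarith
  rcases S.eq_empty_or_nonempty with hemp | hne
  · refine ⟨x, (mem_opResolvent_iff hτ.ne').2 (hA.mem_of_forall fun a b hb => ?_)⟩
    have : (a, x - τ • b) ∈ S := by simpa [hS, smul_smul, hτ.ne'] using hb
    simp [hemp] at this
  set Q := convexHull ℝ ((fun p : H × H => (p.1, p.2, inner ℝ p.1 p.2)) '' S)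
  let f : H × H × ℝ →ₗ[ℝ] H × ℝ :=
    { toFun := fun q => ((1 / 2 : ℝ) • (q.1 + q.2.1), q.2.2)
      map_add' := fun p q => by
        ext
        · simp only [Prod.fst_add, Prod.snd_add, smul_add]; abel
        · simp
      map_smul' := fun c q => by
        ext
        · simp only [Prod.smul_fst, Prod.smul_snd, smul_add, RingHom.id_apply, smul_comm c]
        · simp }
  -- With m = (a + c)/2 one has ⟨p - a, p - c⟩ = ⟨a, c⟩ - ‖m‖² + ‖p - m‖², so the optimality
  -- condition is the maximality test for p in the resolvent.
  obtain ⟨p, hp⟩ := exists_forall_add_norm_sub_sq_le (P := f '' Q)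
    ((convex_convexHull ℝ _).linear_image f)
    (((hne.image _).convexHull).image f) (by
      rintro _ ⟨q, hq, rfl⟩
      have h := le_inner_of_mem_convexHull hanti hq
      have h2 : ‖(1 / 2 : ℝ) • (q.1 + q.2.1)‖ ^ 2
          = inner ℝ q.1 q.2.1 + 1 / 4 * ‖q.1 - q.2.1‖ ^ 2 := by
        rw [norm_smul, mul_pow, norm_add_sq_real, norm_sub_sq_real]
        norm_num
        ring
      change q.2.2 ≤ ‖(1 / 2 : ℝ) • (q.1 + q.2.1)‖ ^ 2
      rw [h2]
      nlinarith [sq_nonneg ‖q.1 - q.2.1‖])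
  refine ⟨p, (mem_opResolvent_iff hτ.ne').2 (hA.mem_of_forall fun a b hb => ?_)⟩
  have hmem : (a, x - τ • b) ∈ S := by simpa [hS, smul_smul, hτ.ne'] using hb
  have h := hp _ ⟨_, subset_convexHull ℝ _ ⟨_, hmem, rfl⟩, rfl⟩
  have h' : inner ℝ a (x - τ • b) - ‖(1 / 2 : ℝ) • (a + (x - τ • b))‖ ^ 2
      + ‖p - (1 / 2 : ℝ) • (a + (x - τ • b))‖ ^ 2 ≤ 0 := h
  set c := x - τ • b with hc
  have h1 : inner ℝ (p - c) (p - a) ≤ 0 := by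
    rw [norm_sub_sq_real] at h'
    simp only [inner_smul_right, inner_add_right, inner_sub_left, inner_sub_right,
      real_inner_self_eq_norm_sq] at h' ⊢
    rw [real_inner_comm a c, real_inner_comm p c]
    linarith
  have h2 : τ⁻¹ • (x - p) - b = -(τ⁻¹ • (p - c)) := by
    rw [hc, ← smul_neg, show -(p - (x - τ • b)) = (x - p) - τ • b by abel,
      smul_sub τ⁻¹ (x - p), smul_smul, inv_mul_cancel₀ hτ.ne', one_smul]
  rw [h2, inner_neg_left, real_inner_smul_left]
  have := mul_nonneg (inv_pos.2 hτ).le (neg_nonneg.2 h1)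
  linarith

theorem IsMonotoneOperator.eq_of_mem_opResolvent {A : H → Set H}
    (hA : IsMonotoneOperator A) {τ : ℝ} (hτ : 0 < τ) {x p p' : H}
    (hp : p ∈ opResolvent τ A x) (hp' : p' ∈ opResolvent τ A x) : p = p' := by
  have := hA.norm_sub_le_of_mem_opResolvent hτ hp hp'
  rwa [sub_self, norm_zero, norm_le_zero_iff, sub_eq_zero] at this

end Resolvent

/-! ### Zeros of Lipschitz perturbations. -/

section ZeroCriterion

variable {K G : Type*} [NormedAddCommGroup K] [InnerProductSpace ℝ K] [CompleteSpace K]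
  [NormedAddCommGroup G] [InnerProductSpace ℝ G] [CompleteSpace G]

/-- A Lipschitz perturbation `C` of the product of two maximally monotone operators contains every
zero that is monotonically related to its graph. -/
theorem IsMaximallyMonotone.neg_mem_and_neg_mem_of_forall {A : K → Set K} {A' : G → Set G}
    (hA : IsMaximallyMonotone A) (hA' : IsMaximallyMonotone A') {C : K × G → K × G} {L : ℝ≥0}
    (hC : LipschitzWith L C) {p : K} {q : G}
    (h : ∀ y u z w, u ∈ A y → w ∈ A' z →
      inner ℝ (u + (C (y, z)).1) (p - y) + inner ℝ (w + (C (y, z)).2) (q - z) ≤ 0) :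
    -(C (p, q)).1 ∈ A p ∧ -(C (p, q)).2 ∈ A' q := by
  obtain ⟨γ, hγ, hγL⟩ : ∃ γ : ℝ≥0, 0 < γ ∧ γ * L < 1 := by
    refine ⟨(L + 1)⁻¹, by positivity, ?_⟩
    rw [inv_mul_lt_iff₀ (by positivity), mul_one]
    exact lt_add_one L
  have hγ' : (0 : ℝ) < γ := hγ
  choose J hJ using fun x => hA.nonempty_opResolvent hγ' x
  choose J' hJ' using fun x => hA'.nonempty_opResolvent hγ' x
  -- A fixed point (y, z) puts γ⁻¹(p - y) - C(y, z)₁, and likewise for z, in the graphs. Inserted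
  -- into `h`, this gives γ⁻¹(‖p - y‖² + ‖q - z‖²) ≤ 0, so maximality of the sum is not needed.
  set T : K × G → K × G := fun x => (J (p - (γ : ℝ) • (C x).1), J' (q - (γ : ℝ) • (C x).2))
  have hT : ContractingWith (γ * L) T := by
    refine ⟨hγL, LipschitzWith.of_dist_le_mul fun x x' => ?_⟩
    have hd := hC.dist_le_mul x x'
    rw [dist_eq_norm (C x), Prod.norm_def, max_le_iff] at hd
    rw [dist_eq_norm (T x), Prod.norm_def, max_le_iff, NNReal.coe_mul, mul_assoc]
    constructor
    · refine (hA.1.norm_sub_le_of_mem_opResolvent hγ' (hJ _) (hJ _)).trans ?_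
      rw [sub_sub_sub_cancel_left, ← smul_sub, norm_smul, Real.norm_of_nonneg hγ'.le, norm_sub_rev]
      exact mul_le_mul_of_nonneg_left hd.1 hγ'.le
    · refine (hA'.1.norm_sub_le_of_mem_opResolvent hγ' (hJ' _) (hJ' _)).trans ?_
      rw [sub_sub_sub_cancel_left, ← smul_sub, norm_smul, Real.norm_of_nonneg hγ'.le, norm_sub_rev]
      exact mul_le_mul_of_nonneg_left hd.2 hγ'.le
  obtain ⟨⟨y, z⟩, hyz⟩ : ∃ x, T x = x := ⟨_, hT.fixedPoint_isFixedPt⟩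
  have hy : J (p - (γ : ℝ) • (C (y, z)).1) = y := congrArg Prod.fst hyz
  have hz : J' (q - (γ : ℝ) • (C (y, z)).2) = z := congrArg Prod.snd hyz
  have hy' := hJ (p - (γ : ℝ) • (C (y, z)).1)
  have hz' := hJ' (q - (γ : ℝ) • (C (y, z)).2)
  rw [hy, mem_opResolvent_iff hγ'.ne'] at hy'
  rw [hz, mem_opResolvent_iff hγ'.ne'] at hz'
  have e1 : (γ : ℝ)⁻¹ • (p - (γ : ℝ) • (C (y, z)).1 - y) = (γ : ℝ)⁻¹ • (p - y) - (C (y, z)).1 := by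
    rw [sub_right_comm, smul_sub _ (p - y), smul_smul, inv_mul_cancel₀ hγ'.ne', one_smul]
  have e2 : (γ : ℝ)⁻¹ • (q - (γ : ℝ) • (C (y, z)).2 - z) = (γ : ℝ)⁻¹ • (q - z) - (C (y, z)).2 := by
    rw [sub_right_comm, smul_sub _ (q - z), smul_smul, inv_mul_cancel₀ hγ'.ne', one_smul]
  rw [e1] at hy'
  rw [e2] at hz'
  have key := h _ _ _ _ hy' hz'
  rw [sub_add_cancel, sub_add_cancel, real_inner_smul_left, real_inner_smul_left, ← mul_add,
    real_inner_self_eq_norm_sq, real_inner_self_eq_norm_sq] at key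
  have h0 : ‖p - y‖ ^ 2 + ‖q - z‖ ^ 2 ≤ 0 := nonpos_of_mul_nonpos_right key (inv_pos.2 hγ')
  have hpy : p = y := by
    rw [← sub_eq_zero, ← norm_eq_zero, ← sq_eq_zero_iff]
    nlinarith [sq_nonneg ‖p - y‖, sq_nonneg ‖q - z‖]
  have hqz : q = z := by
    rw [← sub_eq_zero, ← norm_eq_zero, ← sq_eq_zero_iff]
    nlinarith [sq_nonneg ‖p - y‖, sq_nonneg ‖q - z‖]
  subst hpy hqz
  simp only [sub_self, smul_zero, zero_sub] at hy' hz'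
  exact ⟨hy', hz'⟩

end ZeroCriterion

/-! ### Weak limits along filters. -/

section WeakLimits

variable {H : Type*} [NormedAddCommGroup H] [InnerProductSpace ℝ H]

theorem tendsto_inner_of_tendsto_of_bounded {ι : Type*} {l : Filter ι} {x u : ι → H} {a b : H}
    {R : ℝ} (hR : ∀ᶠ k in l, ‖x k‖ ≤ R) (hu : Tendsto u l (𝓝 b))
    (hx : ∀ v, Tendsto (fun k => inner ℝ (x k) v) l (𝓝 (inner ℝ a v))) :
    Tendsto (fun k => inner ℝ (x k) (u k)) l (𝓝 (inner ℝ a b)) := by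
  have h1 : Tendsto (fun k => inner ℝ (x k) (u k - b)) l (𝓝 0) := by
    have h2 : Tendsto (fun k => R * ‖u k - b‖) l (𝓝 0) := by
      simpa using ((hu.sub_const b).norm).const_mul R
    refine squeeze_zero_norm' ?_ h2
    filter_upwards [hR] with k hk
    exact (norm_inner_le_norm _ _).trans (mul_le_mul_of_nonneg_right hk (norm_nonneg _))
  simpa [inner_sub_right] using h1.add (hx b)

theorem tendsto_inner_sub_sub_of_bounded {ι : Type*} {l : Filter ι} {x r : ι → H} {s b : H}
    {R : ℝ} (hR : ∀ᶠ k in l, ‖x k‖ ≤ R) (hr : Tendsto r l (𝓝 b))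
    (hx : ∀ v, Tendsto (fun k => inner ℝ (x k) v) l (𝓝 (inner ℝ s v))) (a t : H) :
    Tendsto (fun k => inner ℝ (r k - t) (x k - a)) l (𝓝 (inner ℝ (b - t) (s - a))) := by
  have h1 := tendsto_inner_of_tendsto_of_bounded hR (hr.sub_const t) hx
  have h2 : Tendsto (fun k => inner ℝ (r k - t) a) l (𝓝 (inner ℝ (b - t) a)) :=
    (hr.sub_const t).inner tendsto_const_nhds
  simpa only [inner_sub_right, real_inner_comm] using h1.sub h2

variable [CompleteSpace H]

theorem weaklyConverges_iff {x : ℕ → H} {a : H} :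
    WeaklyConverges x a ↔ ∀ v, Tendsto (fun k => inner ℝ (x k) v) atTop (𝓝 (inner ℝ a v)) := by
  have := WeakBilin.tendsto_iff_forall_eval_tendsto (l := atTop)
    (f := fun k => toWeakSpace ℝ H (x k)) (x := toWeakSpace ℝ H a) (topDualPairing ℝ H).flip
    (by
      intro u v huv
      by_contra hne
      refine hne (ext_inner_left ℝ fun w => ?_)
      exact DFunLike.congr_fun huv (InnerProductSpace.toDual ℝ H w))
  refine this.trans ⟨fun h v => ?_, fun h f => ?_⟩
  · simp only [real_inner_comm v]
    exact h (InnerProductSpace.toDual ℝ H v)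
  · have := h ((InnerProductSpace.toDual ℝ H).symm f)
    simp only [real_inner_comm ((InnerProductSpace.toDual ℝ H).symm f),
      InnerProductSpace.toDual_symm_apply] at this
    exact this

/-- Banach–Alaoglu transported by the Riesz isomorphism. Ultrafilters replace weakly convergent
subsequences. -/
theorem exists_tendsto_inner_of_bounded {ι : Type*} (U : Ultrafilter ι) {x : ι → H} {R : ℝ}
    (hx : ∀ᶠ k in (U : Filter ι), ‖x k‖ ≤ R) :
    ∃ a : H, ∀ v, Tendsto (fun k => inner ℝ (x k) v) U (𝓝 (inner ℝ a v)) := by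
  let f : ι → WeakDual ℝ H := fun k => StrongDual.toWeakDual (InnerProductSpace.toDual ℝ H (x k))
  have hc := WeakDual.isCompact_closedBall (𝕜 := ℝ) (E := H) 0 R
  obtain ⟨g, -, hg⟩ := hc.ultrafilter_le_nhds (U.map f) (by
    rw [le_principal_iff]
    change ∀ᶠ k in (U : Filter ι), _
    filter_upwards [hx] with k hk
    simpa [f] using hk)
  refine ⟨(InnerProductSpace.toDual ℝ H).symm (WeakDual.toStrongDual g), fun v => ?_⟩
  have := ((WeakDual.eval_continuous v).tendsto g).comp (show Tendsto f U (𝓝 g) from hg)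
  rw [InnerProductSpace.toDual_symm_apply]
  exact this

end WeakLimits

/-! ### Demiclosedness. -/

section Demiclosed

variable {K G : Type*} [NormedAddCommGroup K] [InnerProductSpace ℝ K] [CompleteSpace K]
  [NormedAddCommGroup G] [InnerProductSpace ℝ G] [CompleteSpace G]

/-- Demiclosedness at zero of the sum of a product of maximally monotone operators and a
monotone Lipschitz map. -/
theorem IsMaximallyMonotone.neg_mem_and_neg_mem_of_tendsto {A : K → Set K} {A' : G → Set G}
    (hA : IsMaximallyMonotone A) (hA' : IsMaximallyMonotone A') {C : K × G → K × G} {L : ℝ≥0}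
    (hC : LipschitzWith L C)
    (hmono : ∀ x x' : K × G,
      0 ≤ inner ℝ ((C x).1 - (C x').1) (x.1 - x'.1) + inner ℝ ((C x).2 - (C x').2) (x.2 - x'.2))
    {ι : Type*} {l : Filter ι} [l.NeBot] {y u : ι → K} {z w : ι → G} {p : K} {q : G} {R : ℝ}
    (hyR : ∀ᶠ k in l, ‖y k‖ ≤ R) (hzR : ∀ᶠ k in l, ‖z k‖ ≤ R)
    (hy : ∀ v, Tendsto (fun k => inner ℝ (y k) v) l (𝓝 (inner ℝ p v)))
    (hz : ∀ v, Tendsto (fun k => inner ℝ (z k) v) l (𝓝 (inner ℝ q v)))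
    (hu : ∀ k, u k ∈ A (y k)) (hw : ∀ k, w k ∈ A' (z k))
    (hu0 : Tendsto (fun k => u k + (C (y k, z k)).1) l (𝓝 0))
    (hw0 : Tendsto (fun k => w k + (C (y k, z k)).2) l (𝓝 0)) :
    -(C (p, q)).1 ∈ A p ∧ -(C (p, q)).2 ∈ A' q := by
  refine hA.neg_mem_and_neg_mem_of_forall hA' hC fun a b c d hb hd => ?_
  -- The residuals converge strongly and the iterates weakly, so the monotonicity pairing passes to
  -- the limit.
  have h1 := (tendsto_inner_sub_sub_of_bounded hyR hu0 hy a (b + (C (a, c)).1)).add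
    (tendsto_inner_sub_sub_of_bounded hzR hw0 hz c (d + (C (a, c)).2))
  have h2 := ge_of_tendsto h1 (b := 0) (Eventually.of_forall fun k => by
    have m1 := hA.1 _ _ _ _ (hu k) hb
    have m2 := hA'.1 _ _ _ _ (hw k) hd
    have m3 := hmono (y k, z k) (a, c)
    simp only at m3
    rw [add_sub_add_comm, add_sub_add_comm, inner_add_left, inner_add_left (w k - d)]
    linarith)
  rw [zero_sub, zero_sub, inner_neg_left, inner_neg_left] at h2
  linarith

end Demiclosed

/-! ### Cocoercive operators. -/

section Cocoercive

variable {K : Type*} [NormedAddCommGroup K] [InnerProductSpace ℝ K]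

theorem IsCocoerciveInv.isMonotoneOperator {β : ℝ} {F : K → K} (hF : IsCocoerciveInv β F) :
    IsMonotoneOperator fun y => {F y} := by
  rintro x y _ _ rfl rfl
  exact le_trans (mul_nonneg (inv_pos.2 hF.1).le (sq_nonneg _)) (hF.2 x y)

theorem IsCocoerciveInv.lipschitzWith {β : ℝ} {F : K → K} (hF : IsCocoerciveInv β F) :
    LipschitzWith β.toNNReal F := by
  refine LipschitzWith.of_dist_le_mul fun x y => ?_
  rw [dist_eq_norm, dist_eq_norm, Real.coe_toNNReal _ hF.1.le]
  have h := (hF.2 x y).trans (real_inner_le_norm _ _)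
  rw [inv_mul_le_iff₀ hF.1] at h
  by_contra! h1
  have := norm_nonneg (x - y)
  nlinarith [mul_nonneg hF.1.le this]

/-- F is evaluated at the old point `x` but tested at the new point `y`. Splitting y - s = (x - s) +
(y - x) and completing the square leaves a defect β/4. -/
theorem IsCocoerciveInv.neg_le_inner {β : ℝ} {F : K → K} (hF : IsCocoerciveInv β F) (x y s : K) :
    -(β / 4 * ‖y - x‖ ^ 2) ≤ inner ℝ (F x - F s) (y - s) := by
  have h := hF.2 x s
  have h1 := neg_le_of_abs_le (abs_real_inner_le_norm (F x - F s) (y - x))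
  rw [show y - s = (x - s) + (y - x) by abel, inner_add_right]
  have h2 : 0 ≤ β⁻¹ * (‖F x - F s‖ - β / 2 * ‖y - x‖) ^ 2 :=
    mul_nonneg (inv_pos.2 hF.1).le (sq_nonneg _)
  have h3 : β⁻¹ * (‖F x - F s‖ - β / 2 * ‖y - x‖) ^ 2
      = β⁻¹ * ‖F x - F s‖ ^ 2 - ‖F x - F s‖ * ‖y - x‖ + β / 4 * ‖y - x‖ ^ 2 := by
    have := hF.1.ne'
    field_simp
    ring
  linarith

end Cocoercive

/-! ### The primal-dual metric. -/

section Metric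

variable {K G : Type*} [NormedAddCommGroup K] [InnerProductSpace ℝ K]
  [NormedAddCommGroup G] [InnerProductSpace ℝ G]

/-- The quadratic form of the block operator `[[τ⁻¹, -V^*], [-V, σ⁻¹]]`. -/
noncomputable def primalDualForm (V : K →L[ℝ] G) (τ σ : ℝ) (y : K) (z : G) : ℝ :=
  τ⁻¹ * ‖y‖ ^ 2 + σ⁻¹ * ‖z‖ ^ 2 - 2 * inner ℝ (V y) z

theorem abs_inner_map_le (V : K →L[ℝ] G) {τ σ : ℝ} (hτ : 0 < τ) (hσ : 0 < σ) (y : K) (z : G) :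
    |inner ℝ (V y) z| ≤ √(τ * σ) * ‖V‖ * ((‖y‖ / √τ) * (‖z‖ / √σ)) := by
  have h1 := Real.sqrt_pos.2 hτ
  have h2 := Real.sqrt_pos.2 hσ
  calc |inner ℝ (V y) z| ≤ ‖V y‖ * ‖z‖ := abs_real_inner_le_norm _ _
    _ ≤ ‖V‖ * ‖y‖ * ‖z‖ := by gcongr; exact V.le_opNorm y
    _ = _ := by
      rw [Real.sqrt_mul hτ.le]
      field_simp

theorem div_sqrt_sq {τ : ℝ} (hτ : 0 < τ) (r : ℝ) : (r / √τ) ^ 2 = τ⁻¹ * r ^ 2 := by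
  rw [div_pow, Real.sq_sqrt hτ.le]
  ring

theorem two_mul_abs_inner_map_le (V : K →L[ℝ] G) {τ σ : ℝ} (hτ : 0 < τ) (hσ : 0 < σ)
    (μ : ℝ) (y : K) (z : G) :
    2 * |μ * inner ℝ (V y) z| ≤ |μ| * √(τ * σ) * ‖V‖ * (τ⁻¹ * ‖y‖ ^ 2 + σ⁻¹ * ‖z‖ ^ 2) := by
  rw [abs_mul, ← div_sqrt_sq hτ, ← div_sqrt_sq hσ]
  have h := mul_le_mul_of_nonneg_left (abs_inner_map_le V hτ hσ y z) (abs_nonneg μ)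
  have h1 : 0 ≤ |μ| * √(τ * σ) * ‖V‖ := by positivity
  nlinarith [mul_nonneg h1 (sq_nonneg (‖y‖ / √τ - ‖z‖ / √σ))]

/-- In the variables ‖y‖/√τ and ‖z‖/√σ this is positivity of a 2×2 form with off-diagonal entry c =
√(τσ)‖V‖. The determinant condition holds because (1 - a - ε/2)(1 - b - ε/2) ≥ 1 - a - b - ε ≥ c².
-/
theorem le_primalDualForm_sub (V : K →L[ℝ] G) {τ σ a b ε : ℝ} (hτ : 0 < τ) (hσ : 0 < σ)
    (ha : 0 ≤ a) (hb : 0 ≤ b) (hε : 0 < ε) (h : τ * σ * ‖V‖ ^ 2 + a + b ≤ 1 - ε) (y : K) (z : G) :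
    ε / 2 * (τ⁻¹ * ‖y‖ ^ 2 + σ⁻¹ * ‖z‖ ^ 2)
      ≤ primalDualForm V τ σ y z - a * (τ⁻¹ * ‖y‖ ^ 2) - b * (σ⁻¹ * ‖z‖ ^ 2) := by
  have h0 := (abs_le.1 (abs_inner_map_le V hτ hσ y z)).2
  rw [primalDualForm, ← div_sqrt_sq hτ, ← div_sqrt_sq hσ]
  set X := ‖y‖ / √τ
  set Y := ‖z‖ / √σ
  set c := √(τ * σ) * ‖V‖ with hc
  have hc2 : τ * σ * ‖V‖ ^ 2 = c ^ 2 := by rw [hc, mul_pow, Real.sq_sqrt (by positivity)]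
  rw [hc2] at h
  have hP : 0 < 1 - a - ε / 2 := by nlinarith [sq_nonneg c]
  have hPQ : c ^ 2 ≤ (1 - a - ε / 2) * (1 - b - ε / 2) := by
    nlinarith [mul_nonneg ha hb, mul_nonneg ha hε.le, mul_nonneg hb hε.le, sq_nonneg ε]
  have key : 0 ≤ (1 - a - ε / 2) * ((1 - a - ε / 2) * X ^ 2 + (1 - b - ε / 2) * Y ^ 2
      - 2 * (c * (X * Y))) := by
    nlinarith [sq_nonneg ((1 - a - ε / 2) * X - c * Y),
      mul_nonneg (sub_nonneg.2 hPQ) (sq_nonneg Y)]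
  have := nonneg_of_mul_nonneg_right key hP
  linarith

theorem primalDualForm_add (V : K →L[ℝ] G) (τ σ : ℝ) (y y' : K) (z z' : G) :
    primalDualForm V τ σ (y + y') (z + z')
      = primalDualForm V τ σ y z + primalDualForm V τ σ y' z'
        + 2 * (τ⁻¹ * inner ℝ y y' + σ⁻¹ * inner ℝ z z' - inner ℝ (V y) z' - inner ℝ z (V y')) := by
  simp only [primalDualForm, norm_add_sq_real, map_add, inner_add_left, inner_add_right,
    real_inner_comm z (V y')]
  ring

end Metric

/-! ### One-step energy inequality. -/

section Energy

variable {K G : Type*} [NormedAddCommGroup K] [InnerProductSpace ℝ K] [CompleteSpace K]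
  [NormedAddCommGroup G] [InnerProductSpace ℝ G] [CompleteSpace G]

/-- The primal-dual quadratic form at `(Y, Z)` corrected by the momentum terms. -/
noncomputable def momentumEnergy (V : K →L[ℝ] G) (τ σ μ : ℝ) (e d Y : K) (Z : G) : ℝ :=
  primalDualForm V τ σ Y Z - 2 * inner ℝ e Y + 2 * (μ * inner ℝ (V d) Z)

/-- Twice the sum of the four hypotheses, after polarisation. In 2 - μ₂, one copy of V(y₂ - y₁)
supplies the off-diagonal block of the metric and the other turns V y₁ into V y₂, so that the skew
coupling with V^* cancels; the remaining -μ₂ and μ₁ terms telescope. -/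
theorem momentumEnergy_succ_le (V : K →L[ℝ] G) {τ σ β μ₁ μ₂ : ℝ}
    {y₀ y₁ y₂ s e₀ e₁ e₂ es f₁ fs : K} {z₁ z₂ t : G}
    (hB : 0 ≤ inner ℝ (τ⁻¹ • (y₁ - y₂) - V.adjoint z₁ - ((2 : ℝ) • e₁ - e₀) - f₁
      - (-V.adjoint t - es - fs)) (y₂ - s))
    (hD : 0 ≤ inner ℝ (σ⁻¹ • (z₁ - z₂) + V (y₁ + ((2 - μ₂) • (y₂ - y₁) + μ₁ • (y₁ - y₀))) - V s)
      (z₂ - t))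
    (hE : 0 ≤ inner ℝ (e₂ - es) (y₂ - s))
    (hF : -(β / 4 * ‖y₂ - y₁‖ ^ 2) ≤ inner ℝ (f₁ - fs) (y₂ - s)) :
    momentumEnergy V τ σ μ₂ (e₂ - e₁) (y₂ - y₁) (y₂ - s) (z₂ - t)
      ≤ momentumEnergy V τ σ μ₁ (e₁ - e₀) (y₁ - y₀) (y₁ - s) (z₁ - t)
        - primalDualForm V τ σ (y₂ - y₁) (z₂ - z₁) - 2 * inner ℝ (e₁ - e₀) (y₂ - y₁)
        + 2 * (μ₁ * inner ℝ (V (y₁ - y₀)) (z₂ - z₁)) + β / 2 * ‖y₂ - y₁‖ ^ 2 := by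
  obtain ⟨Y, rfl⟩ : ∃ Y, y₂ = s + Y := ⟨y₂ - s, by abel⟩
  obtain ⟨d, rfl⟩ : ∃ d, y₁ = s + Y - d := ⟨s + Y - y₁, by abel⟩
  obtain ⟨d', rfl⟩ : ∃ d', y₀ = s + Y - d - d' := ⟨s + Y - d - y₀, by abel⟩
  obtain ⟨Z, rfl⟩ : ∃ Z, z₂ = t + Z := ⟨z₂ - t, by abel⟩
  obtain ⟨w, rfl⟩ : ∃ w, z₁ = t + Z - w := ⟨t + Z - z₁, by abel⟩
  obtain ⟨g, rfl⟩ : ∃ g, f₁ = fs + g := ⟨f₁ - fs, by abel⟩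
  have r1 : s + Y - d - (s + Y) = -d := by abel
  have r2 : s + Y - s = Y := by abel
  have r3 : s + Y - (s + Y - d) = d := by abel
  have r4 : s + Y - d - (s + Y - d - d') = d' := by abel
  have r5 : t + Z - w - (t + Z) = -w := by abel
  have r6 : t + Z - t = Z := by abel
  have r7 : t + Z - (t + Z - w) = w := by abel
  have r8 : s + Y - d - s = Y - d := by abel
  have r9 : t + Z - w - t = Z - w := by abel
  have r10 : fs + g - fs = g := by abel
  simp only [r1, r2, r3, r4, r5, r6, r7, r8, r9, r10] at *
  simp only [momentumEnergy, primalDualForm, ← real_inner_self_eq_norm_sq, inner_add_left,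
    inner_sub_left, inner_sub_right, inner_neg_left, real_inner_smul_left, map_add,
    map_sub, map_smul, ContinuousLinearMap.adjoint_inner_left, smul_neg,
    real_inner_comm (V Y) _, real_inner_comm d Y, real_inner_comm w Z] at *
  nlinarith

end Energy

/-! ### Descent and coercivity of the corrected energy. -/

section Descent

variable {K G : Type*} [NormedAddCommGroup K] [InnerProductSpace ℝ K]
  [NormedAddCommGroup G] [InnerProductSpace ℝ G]

theorem two_mul_abs_inner_le_of_norm_le {δ : ℝ} {e d x : K} (he : ‖e‖ ≤ δ * ‖d‖) (hδ : 0 ≤ δ) :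
    2 * |inner ℝ e x| ≤ δ * (‖d‖ ^ 2 + ‖x‖ ^ 2) := by
  have h := (abs_real_inner_le_norm e x).trans (mul_le_mul_of_nonneg_right he (norm_nonneg x))
  nlinarith [mul_nonneg hδ (sq_nonneg (‖d‖ - ‖x‖))]

theorem le_momentumEnergy_add (V : K →L[ℝ] G) {τ σ δ μ ε : ℝ} (hτ : 0 < τ) (hσ : 0 < σ)
    (hδ : 0 ≤ δ) (hε : 0 < ε)
    (h : τ * σ * ‖V‖ ^ 2 + τ * δ + |μ| * √(τ * σ) * ‖V‖ ≤ 1 - ε)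
    {e d : K} (he : ‖e‖ ≤ δ * ‖d‖) (Y : K) (Z : G) :
    ε / 2 * (τ⁻¹ * ‖Y‖ ^ 2 + σ⁻¹ * ‖Z‖ ^ 2) ≤ momentumEnergy V τ σ μ e d Y Z
      + (τ * δ + |μ| * √(τ * σ) * ‖V‖) * (τ⁻¹ * ‖d‖ ^ 2) := by
  have h1 := le_primalDualForm_sub V hτ hσ (by positivity) (by positivity) hε h Y Z
  have h2 := (two_mul_abs_inner_le_of_norm_le (x := Y) he hδ)
  have h3 := two_mul_abs_inner_map_le V hτ hσ μ d Z
  have h4 := neg_abs_le (μ * inner ℝ (V d) Z)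
  have h5 := le_abs_self (inner ℝ e Y)
  have h6 : ∀ r : ℝ, τ * δ * (τ⁻¹ * r) = δ * r := fun r => by field_simp
  rw [h6] at h1
  rw [momentumEnergy, add_mul, h6]
  linarith

theorem momentumEnergy_descent (V : K →L[ℝ] G) {τ σ δ β μ₁ μ₂ ε : ℝ} (hτ : 0 < τ) (hσ : 0 < σ)
    (hδ : 0 ≤ δ) (hβ : 0 ≤ β) (hε : 0 < ε)
    (h : τ * σ * ‖V‖ ^ 2 + (|μ₁| + |μ₂|) * √(τ * σ) * ‖V‖ + τ * (2 * δ + 1 / 2 * β) ≤ 1 - ε)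
    {A A' : ℝ} {e d d' : K} {w : G} (he : ‖e‖ ≤ δ * ‖d‖)
    (hA : A' ≤ A - primalDualForm V τ σ d' w - 2 * inner ℝ e d'
      + 2 * (μ₁ * inner ℝ (V d) w) + β / 2 * ‖d'‖ ^ 2) :
    A' + (τ * δ + |μ₂| * √(τ * σ) * ‖V‖) * (τ⁻¹ * ‖d'‖ ^ 2)
      + ε / 2 * (τ⁻¹ * ‖d'‖ ^ 2 + σ⁻¹ * ‖w‖ ^ 2)
      ≤ A + (τ * δ + |μ₁| * √(τ * σ) * ‖V‖) * (τ⁻¹ * ‖d‖ ^ 2) := by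
  -- The weight `a` pays on `d'` for Young's inequality (δ), the defect of F (β/2) and the
  -- correction carried to the next energy (δ and |μ₂|). The weight `b` pays on `w` for the μ₁
  -- product.
  have h1 := le_primalDualForm_sub V hτ hσ (a := τ * (2 * δ + 1 / 2 * β) + |μ₂| * √(τ * σ) * ‖V‖)
    (b := |μ₁| * √(τ * σ) * ‖V‖) (by positivity) (by positivity) hε (by linarith) d' w
  have h2 := (two_mul_abs_inner_le_of_norm_le (x := d') he hδ)
  have h3 := two_mul_abs_inner_map_le V hτ hσ μ₁ d w
  have h4 := le_abs_self (μ₁ * inner ℝ (V d) w)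
  have h5 := neg_abs_le (inner ℝ e d')
  have h6 : ∀ c r : ℝ, τ * c * (τ⁻¹ * r) = c * r := fun c r => by field_simp
  rw [add_mul, h6] at h1
  rw [add_mul, add_mul, h6, h6]
  linarith

theorem abs_momentumEnergy_sub_le (V : K →L[ℝ] G) {τ σ δ μ R : ℝ} (hτ : 0 < τ) (hσ : 0 < σ)
    (hμ : |μ| * √(τ * σ) * ‖V‖ ≤ 1) (hδμ : τ * δ + |μ| * √(τ * σ) * ‖V‖ ≤ 1)
    (hδ : 0 ≤ δ) {e d Y : K} {Z : G} (he : ‖e‖ ≤ δ * ‖d‖) (hY : ‖Y‖ ≤ R) (hZ : ‖Z‖ ≤ R) :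
    |momentumEnergy V τ σ μ e d Y Z + (τ * δ + |μ| * √(τ * σ) * ‖V‖) * (τ⁻¹ * ‖d‖ ^ 2)
      - primalDualForm V τ σ Y Z|
      ≤ 2 * (δ * ‖d‖ * R) + 2 * ((√(τ * σ))⁻¹ * ‖d‖ * R) + τ⁻¹ * ‖d‖ ^ 2 := by
  have hs : 0 < √(τ * σ) := Real.sqrt_pos.2 (by positivity)
  have h1 : |inner ℝ e Y| ≤ δ * ‖d‖ * R :=
    (abs_real_inner_le_norm _ _).trans (mul_le_mul he hY (norm_nonneg _) (by positivity))
  have h2 : |μ * inner ℝ (V d) Z| ≤ (√(τ * σ))⁻¹ * ‖d‖ * R := by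
    -- Only the product |μ|‖V‖ is controlled: if V = 0, the relaxation parameters may be unbounded.
    have h3 : |μ| * ‖V‖ ≤ (√(τ * σ))⁻¹ := by
      rw [← one_div, le_div_iff₀ hs]
      linarith
    calc |μ * inner ℝ (V d) Z| ≤ |μ| * (‖V‖ * ‖d‖ * ‖Z‖) := by
          rw [abs_mul]
          gcongr
          refine (abs_real_inner_le_norm _ _).trans ?_
          gcongr
          exact V.le_opNorm d
      _ = |μ| * ‖V‖ * ‖d‖ * ‖Z‖ := by ring
      _ ≤ _ := by gcongr
  have h4 : 0 ≤ (τ * δ + |μ| * √(τ * σ) * ‖V‖) * (τ⁻¹ * ‖d‖ ^ 2) := by positivity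
  have h5 : (τ * δ + |μ| * √(τ * σ) * ‖V‖) * (τ⁻¹ * ‖d‖ ^ 2) ≤ τ⁻¹ * ‖d‖ ^ 2 :=
    mul_le_of_le_one_left (by positivity) hδμ
  rw [abs_le] at h1 h2 ⊢
  unfold momentumEnergy
  constructor <;> linarith

end Descent

/-! ### Asymptotics of the iterates. -/

section Iterates

variable {K G : Type*} [NormedAddCommGroup K] [InnerProductSpace ℝ K]
  [NormedAddCommGroup G] [InnerProductSpace ℝ G]

theorem tendsto_zero_of_mul_sq_norm_le {H : Type*} [NormedAddCommGroup H] {x : ℕ → H} {v : ℕ → ℝ}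
    {c : ℝ} (hc : 0 < c) (h : ∀ n, c * ‖x n‖ ^ 2 ≤ v n) (hv : Tendsto v atTop (𝓝 0)) :
    Tendsto x atTop (𝓝 0) := by
  have h1 : Tendsto (fun n => √(v n / c)) atTop (𝓝 0) := by
    simpa using (hv.div_const c).sqrt
  refine squeeze_zero_norm (fun n => Real.le_sqrt_of_sq_le ?_) h1
  rw [le_div_iff₀ hc, mul_comm]
  exact h n

/-- Quasi-Fejér-type consequences of a descent inequality for the momentum energy. -/
theorem asymptotics_of_momentumEnergy_le (V : K →L[ℝ] G) {τ σ δ β ε : ℝ} (hτ : 0 < τ)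
    (hσ : 0 < σ) (hδ : 0 ≤ δ) (hβ : 0 ≤ β) (hε : 0 < ε) {μ : ℕ → ℝ}
    (h : ∀ n, τ * σ * ‖V‖ ^ 2 + (|μ n| + |μ (n + 1)|) * √(τ * σ) * ‖V‖
      + τ * (2 * δ + 1 / 2 * β) ≤ 1 - ε)
    {y e : ℕ → K} {z : ℕ → G} {s : K} {t : G}
    (he : ∀ n, ‖e n‖ ≤ δ * ‖y (n + 1) - y n‖)
    (hstep : ∀ n, momentumEnergy V τ σ (μ (n + 1)) (e (n + 1)) (y (n + 2) - y (n + 1))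
        (y (n + 2) - s) (z (n + 2) - t)
      ≤ momentumEnergy V τ σ (μ n) (e n) (y (n + 1) - y n) (y (n + 1) - s) (z (n + 1) - t)
        - primalDualForm V τ σ (y (n + 2) - y (n + 1)) (z (n + 2) - z (n + 1))
        - 2 * inner ℝ (e n) (y (n + 2) - y (n + 1))
        + 2 * (μ n * inner ℝ (V (y (n + 1) - y n)) (z (n + 2) - z (n + 1)))
        + β / 2 * ‖y (n + 2) - y (n + 1)‖ ^ 2) :
    (∃ R, ∀ n, ‖y (n + 1)‖ ≤ R ∧ ‖z (n + 1)‖ ≤ R) ∧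
    Tendsto (fun n => y (n + 1) - y n) atTop (𝓝 0) ∧
    Tendsto (fun n => z (n + 1) - z n) atTop (𝓝 0) ∧
    ∃ ℓ, Tendsto (fun n => primalDualForm V τ σ (y (n + 1) - s) (z (n + 1) - t)) atTop (𝓝 ℓ) := by
  set U : ℕ → ℝ := fun n =>
    momentumEnergy V τ σ (μ n) (e n) (y (n + 1) - y n) (y (n + 1) - s) (z (n + 1) - t)
      + (τ * δ + |μ n| * √(τ * σ) * ‖V‖) * (τ⁻¹ * ‖y (n + 1) - y n‖ ^ 2) with hU
  have hμ : ∀ n, τ * σ * ‖V‖ ^ 2 + τ * δ + |μ n| * √(τ * σ) * ‖V‖ ≤ 1 - ε := by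
    intro n
    have h1 : 0 ≤ |μ (n + 1)| * √(τ * σ) * ‖V‖ := by positivity
    have h2 : 0 ≤ τ * β := by positivity
    have h3 : 0 ≤ τ * δ := by positivity
    linarith [h n]
  have hdesc : ∀ n, U (n + 1) + ε / 2 * (τ⁻¹ * ‖y (n + 2) - y (n + 1)‖ ^ 2
      + σ⁻¹ * ‖z (n + 2) - z (n + 1)‖ ^ 2) ≤ U n := fun n =>
    momentumEnergy_descent V hτ hσ hδ hβ hε (h n) (he n) (hstep n)
  have hlow : ∀ n, ε / 2 * (τ⁻¹ * ‖y (n + 1) - s‖ ^ 2 + σ⁻¹ * ‖z (n + 1) - t‖ ^ 2) ≤ U n :=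
    fun n => le_momentumEnergy_add V hτ hσ hδ hε (hμ n) (he n) _ _
  have hanti : Antitone U := antitone_nat_of_succ_le fun n =>
    le_trans (le_add_of_nonneg_right (by positivity)) (hdesc n)
  have hbdd : BddBelow (Set.range U) := ⟨0, by
    rintro _ ⟨n, rfl⟩
    exact le_trans (by positivity) (hlow n)⟩
  have hlim := tendsto_atTop_ciInf hanti hbdd
  have hlim' := (tendsto_add_atTop_iff_nat 1).2 hlim
  have hdiff : Tendsto (fun n => U n - U (n + 1)) atTop (𝓝 0) := by simpa using hlim.sub hlim'
  have hy0 : Tendsto (fun n => y (n + 1) - y n) atTop (𝓝 0) := by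
    refine (tendsto_add_atTop_iff_nat 1).1 (tendsto_zero_of_mul_sq_norm_le
      (c := ε / 2 * τ⁻¹) (by positivity) (fun n => ?_) hdiff)
    have : 0 ≤ ε / 2 * (σ⁻¹ * ‖z (n + 2) - z (n + 1)‖ ^ 2) := by positivity
    linarith [hdesc n]
  have hz0 : Tendsto (fun n => z (n + 1) - z n) atTop (𝓝 0) := by
    refine (tendsto_add_atTop_iff_nat 1).1 (tendsto_zero_of_mul_sq_norm_le
      (c := ε / 2 * σ⁻¹) (by positivity) (fun n => ?_) hdiff)
    have : 0 ≤ ε / 2 * (τ⁻¹ * ‖y (n + 2) - y (n + 1)‖ ^ 2) := by positivity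
    linarith [hdesc n]
  obtain ⟨R, hR⟩ : ∃ R, ∀ n, ‖y (n + 1) - s‖ ≤ R ∧ ‖z (n + 1) - t‖ ≤ R := by
    refine ⟨max √(U 0 / (ε / 2 * τ⁻¹)) √(U 0 / (ε / 2 * σ⁻¹)), fun n => ⟨?_, ?_⟩⟩
    · refine le_max_of_le_left (Real.le_sqrt_of_sq_le ?_)
      rw [le_div_iff₀ (by positivity)]
      have : 0 ≤ ε / 2 * (σ⁻¹ * ‖z (n + 1) - t‖ ^ 2) := by positivity
      linarith [hlow n, hanti (Nat.zero_le n)]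
    · refine le_max_of_le_right (Real.le_sqrt_of_sq_le ?_)
      rw [le_div_iff₀ (by positivity)]
      have : 0 ≤ ε / 2 * (τ⁻¹ * ‖y (n + 1) - s‖ ^ 2) := by positivity
      linarith [hlow n, hanti (Nat.zero_le n)]
  refine ⟨⟨R + max ‖s‖ ‖t‖, fun n => ⟨?_, ?_⟩⟩, hy0, hz0, ⨅ n, U n, ?_⟩
  · calc ‖y (n + 1)‖ = ‖(y (n + 1) - s) + s‖ := by rw [sub_add_cancel]
      _ ≤ _ := (norm_add_le _ _).trans (add_le_add (hR n).1 (le_max_left _ _))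
  · calc ‖z (n + 1)‖ = ‖(z (n + 1) - t) + t‖ := by rw [sub_add_cancel]
      _ ≤ _ := (norm_add_le _ _).trans (add_le_add (hR n).2 (le_max_right _ _))
  · have hn : Tendsto (fun n => ‖y (n + 1) - y n‖) atTop (𝓝 0) := by simpa using hy0.norm
    have hb : Tendsto (fun n => 2 * (δ * ‖y (n + 1) - y n‖ * R)
        + 2 * ((√(τ * σ))⁻¹ * ‖y (n + 1) - y n‖ * R) + τ⁻¹ * ‖y (n + 1) - y n‖ ^ 2)
        atTop (𝓝 0) := by
      simpa using ((((hn.const_mul δ).mul_const R).const_mul 2).add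
        (((hn.const_mul (√(τ * σ))⁻¹).mul_const R).const_mul 2)).add ((hn.pow 2).const_mul τ⁻¹)
    have hd := squeeze_zero_norm (fun n => ?_) hb (f := fun n =>
      U n - primalDualForm V τ σ (y (n + 1) - s) (z (n + 1) - t))
    · simpa using hlim.sub hd
    · have h1 : 0 ≤ τ * σ * ‖V‖ ^ 2 := by positivity
      have h2 : 0 ≤ τ * δ := by positivity
      exact abs_momentumEnergy_sub_le V hτ hσ (by linarith [hμ n]) (by linarith [hμ n]) hδ (he n)
        (hR n).1 (hR n).2

end Iterates

/-! ### Opial's lemma. -/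

section Opial

variable {K G : Type*} [NormedAddCommGroup K] [InnerProductSpace ℝ K] [CompleteSpace K]
  [NormedAddCommGroup G] [InnerProductSpace ℝ G] [CompleteSpace G]

/-- Expanding around the weak limit (p, q), the cross terms are continuous linear functionals of the
deviation and vanish. -/
theorem tendsto_primalDualForm_of_weak {V : K →L[ℝ] G} {τ σ ℓ : ℝ} {ι : Type*} {l : Filter ι}
    {y : ι → K} {z : ι → G} {p : K} {q : G}
    (hy : ∀ v, Tendsto (fun k => inner ℝ (y k) v) l (𝓝 (inner ℝ p v)))
    (hz : ∀ v, Tendsto (fun k => inner ℝ (z k) v) l (𝓝 (inner ℝ q v)))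
    (hℓ : Tendsto (fun k => primalDualForm V τ σ (y k - p) (z k - q)) l (𝓝 ℓ)) (s : K) (t : G) :
    Tendsto (fun k => primalDualForm V τ σ (y k - s) (z k - t)) l
      (𝓝 (ℓ + primalDualForm V τ σ (p - s) (q - t))) := by
  have hy' : ∀ v, Tendsto (fun k => inner ℝ (y k - p) v) l (𝓝 0) := fun v => by
    simpa [inner_sub_left] using (hy v).sub_const (inner ℝ p v)
  have hz' : ∀ v, Tendsto (fun k => inner ℝ (z k - q) v) l (𝓝 0) := fun v => by
    simpa [inner_sub_left] using (hz v).sub_const (inner ℝ q v)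
  have hlin : Tendsto (fun k => 2 * (τ⁻¹ * inner ℝ (y k - p) (p - s)
      + σ⁻¹ * inner ℝ (z k - q) (q - t) - inner ℝ (V (y k - p)) (q - t)
      - inner ℝ (z k - q) (V (p - s)))) l (𝓝 0) := by
    have h3 := hy' (V.adjoint (q - t))
    simp only [ContinuousLinearMap.adjoint_inner_right] at h3
    simpa using ((((hy' (p - s)).const_mul τ⁻¹).add ((hz' (q - t)).const_mul σ⁻¹)).sub h3).sub
      (hz' (V (p - s))) |>.const_mul 2
  have := (hℓ.add_const (primalDualForm V τ σ (p - s) (q - t))).add hlin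
  rw [add_zero] at this
  refine this.congr fun k => ?_
  rw [← primalDualForm_add, sub_add_sub_cancel, sub_add_sub_cancel]

/-- Opial's lemma for the primal-dual metric. -/
theorem exists_weak_limit_of_primalDualForm {V : K →L[ℝ] G} {τ σ R : ℝ} (hτ : 0 < τ) (hσ : 0 < σ)
    (hV : τ * σ * ‖V‖ ^ 2 < 1) {y : ℕ → K} {z : ℕ → G} {S : K → G → Prop}
    (hyR : ∀ n, ‖y n‖ ≤ R) (hzR : ∀ n, ‖z n‖ ≤ R)
    (hconv : ∀ s t, S s t →
      ∃ ℓ, Tendsto (fun n => primalDualForm V τ σ (y n - s) (z n - t)) atTop (𝓝 ℓ))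
    (hclus : ∀ (U : Ultrafilter ℕ) (p : K) (q : G), (U : Filter ℕ) ≤ atTop →
      (∀ v, Tendsto (fun n => inner ℝ (y n) v) U (𝓝 (inner ℝ p v))) →
      (∀ v, Tendsto (fun n => inner ℝ (z n) v) U (𝓝 (inner ℝ q v))) → S p q) :
    ∃ p q, S p q ∧ WeaklyConverges y p ∧ WeaklyConverges z q := by
  have hlim : ∀ U : Ultrafilter ℕ, ∃ p : K, ∃ q : G,
      (∀ v, Tendsto (fun n => inner ℝ (y n) v) U (𝓝 (inner ℝ p v))) ∧
      (∀ v, Tendsto (fun n => inner ℝ (z n) v) U (𝓝 (inner ℝ q v))) := by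
    intro U
    obtain ⟨p, hp⟩ := exists_tendsto_inner_of_bounded U (Eventually.of_forall hyR)
    obtain ⟨q, hq⟩ := exists_tendsto_inner_of_bounded U (Eventually.of_forall hzR)
    exact ⟨p, q, hp, hq⟩
  have huniq : ∀ (U U' : Ultrafilter ℕ) (p p' : K) (q q' : G),
      (U : Filter ℕ) ≤ atTop → (U' : Filter ℕ) ≤ atTop →
      (∀ v, Tendsto (fun n => inner ℝ (y n) v) U (𝓝 (inner ℝ p v))) →
      (∀ v, Tendsto (fun n => inner ℝ (z n) v) U (𝓝 (inner ℝ q v))) →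
      (∀ v, Tendsto (fun n => inner ℝ (y n) v) U' (𝓝 (inner ℝ p' v))) →
      (∀ v, Tendsto (fun n => inner ℝ (z n) v) U' (𝓝 (inner ℝ q' v))) → p = p' ∧ q = q' := by
    intro U U' p p' q q' hU hU' hp hq hp' hq'
    obtain ⟨ℓ, hℓ⟩ := hconv p q (hclus U p q hU hp hq)
    obtain ⟨ℓ', hℓ'⟩ := hconv p' q' (hclus U' p' q' hU' hp' hq')
    -- Comparing limits both ways gives ℓ' = ℓ + form(p - p', q - q') and ℓ = ℓ' + form(p' - p, q' -
    -- q). The two values sum to zero, and definiteness forces equality.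
    have h1 := tendsto_nhds_unique (hℓ'.mono_left hU)
      (tendsto_primalDualForm_of_weak hp hq (hℓ.mono_left hU) p' q')
    have h2 := tendsto_nhds_unique (hℓ.mono_left hU')
      (tendsto_primalDualForm_of_weak hp' hq' (hℓ'.mono_left hU') p q)
    have h3 := le_primalDualForm_sub V hτ hσ le_rfl le_rfl (sub_pos.2 hV) (by simp)
      (p - p') (q - q')
    have h4 := le_primalDualForm_sub V hτ hσ le_rfl le_rfl (sub_pos.2 hV) (by simp)
      (p' - p) (q' - q)
    have hc : 0 < (1 - τ * σ * ‖V‖ ^ 2) / 2 := by linarith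
    have h4' : 0 ≤ (1 - τ * σ * ‖V‖ ^ 2) / 2
      * (τ⁻¹ * ‖p' - p‖ ^ 2 + σ⁻¹ * ‖q' - q‖ ^ 2) := by positivity
    have h5 : τ⁻¹ * ‖p - p'‖ ^ 2 + σ⁻¹ * ‖q - q'‖ ^ 2 ≤ 0 :=
      nonpos_of_mul_nonpos_right (by linarith) hc
    have h6 : 0 ≤ τ⁻¹ * ‖p - p'‖ ^ 2 := by positivity
    have h7 : 0 ≤ σ⁻¹ * ‖q - q'‖ ^ 2 := by positivity
    have h8 : τ⁻¹ * ‖p - p'‖ ^ 2 = 0 := by linarith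
    have h9 : σ⁻¹ * ‖q - q'‖ ^ 2 = 0 := by linarith
    simp only [mul_eq_zero, inv_eq_zero, hτ.ne', hσ.ne', false_or, sq_eq_zero_iff, norm_eq_zero,
      sub_eq_zero] at h8 h9
    exact ⟨h8, h9⟩
  obtain ⟨U₀, hU₀⟩ := Ultrafilter.exists_le (atTop : Filter ℕ)
  obtain ⟨p, q, hp, hq⟩ := hlim U₀
  refine ⟨p, q, hclus U₀ p q hU₀ hp hq, weaklyConverges_iff.2 fun v => ?_,
    weaklyConverges_iff.2 fun v => ?_⟩ <;>
  · rw [tendsto_iff_ultrafilter]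
    intro U hU
    obtain ⟨p', q', hp', hq'⟩ := hlim U
    obtain ⟨rfl, rfl⟩ := huniq U₀ U p p' q q' hU₀ hU hp hq hp' hq'
    first | exact hp' v | exact hq' v

end Opial

/-! ### Primal and primal-dual solutions. -/

section Solutions

variable {K G : Type*} [NormedAddCommGroup K] [InnerProductSpace ℝ K] [CompleteSpace K]
  [NormedAddCommGroup G] [InnerProductSpace ℝ G] [CompleteSpace G]

theorem isPrimalDualSolution_iff {B : K → Set K} {D : G → Set G} {E F : K → K} {V : K →L[ℝ] G}
    {y : K} {z : G} :
    IsPrimalDualSolution B D E F V y z ↔ -(V.adjoint z + E y + F y) ∈ B y ∧ z ∈ D (V y) := by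
  simp only [IsPrimalDualSolution, Set.add_singleton, Set.sub_singleton, Set.mem_image,
    opInverse, Set.mem_ofPred_eq, exists_exists_and_eq_and, sub_eq_zero, exists_eq_right]
  refine and_congr_left fun _ => ⟨?_, fun h => ⟨_, h, by abel⟩⟩
  rintro ⟨u, hu, h⟩
  rwa [show -(V.adjoint z + E y + F y) = u by rw [← sub_eq_zero, ← neg_eq_zero, ← h]; abel]

theorem isPrimalSolution_iff {B : K → Set K} {D : G → Set G} {E F : K → K} {V : K →L[ℝ] G}
    {y : K} :
    IsPrimalSolution B D E F V y ↔ ∃ z, IsPrimalDualSolution B D E F V y z := by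
  simp only [isPrimalDualSolution_iff, IsPrimalSolution, Set.add_singleton, Set.mem_image,
    exists_exists_and_eq_and, Set.mem_add]
  constructor
  · rintro ⟨_, ⟨u, hu, z, hz, rfl⟩, h⟩
    refine ⟨z, ?_, hz⟩
    rwa [show -(V.adjoint z + E y + F y) = u by rw [← sub_eq_zero, ← neg_eq_zero, ← h]; abel]
  · rintro ⟨z, hu, hz⟩
    exact ⟨_, ⟨_, hu, z, hz, rfl⟩, by abel⟩

/-- The Lipschitz part of the primal-dual inclusion. -/
noncomputable def primalDualMap (E F : K → K) (V : K →L[ℝ] G) (x : K × G) : K × G :=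
  (V.adjoint x.2 + E x.1 + F x.1, -V x.1)

theorem exists_lipschitzWith_primalDualMap {E F : K → K} (V : K →L[ℝ] G) {δ β : ℝ≥0}
    (hE : LipschitzWith δ E) (hF : LipschitzWith β F) :
    ∃ L, LipschitzWith L (primalDualMap E F V) :=
  ⟨_, (((V.adjoint.lipschitz.comp LipschitzWith.prod_snd).add
    (hE.comp LipschitzWith.prod_fst)).add (hF.comp LipschitzWith.prod_fst)).prodMk
    (V.lipschitz.comp LipschitzWith.prod_fst).neg⟩

/-- The blocks V^* and -V form a skew operator and cancel, leaving E and F. -/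
theorem primalDualMap_monotone {E F : K → K} (V : K →L[ℝ] G)
    (hE : IsMonotoneOperator fun y => {E y}) (hF : IsMonotoneOperator fun y => {F y})
    (x x' : K × G) :
    0 ≤ inner ℝ ((primalDualMap E F V x).1 - (primalDualMap E F V x').1) (x.1 - x'.1)
      + inner ℝ ((primalDualMap E F V x).2 - (primalDualMap E F V x').2) (x.2 - x'.2) := by
  have h1 := hE x.1 x'.1 _ _ rfl rfl
  have h2 := hF x.1 x'.1 _ _ rfl rfl
  simp only [primalDualMap, add_sub_add_comm, inner_add_left _ (F x.1 - F x'.1),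
    inner_add_left _ (E x.1 - E x'.1), ← map_sub, ContinuousLinearMap.adjoint_inner_left,
    neg_sub_neg]
  rw [← neg_sub x.1 x'.1, map_neg, inner_neg_left, real_inner_comm (x.2 - x'.2)]
  linarith

end Solutions

/-! ### Well-posedness and weak convergence. -/

section Main

variable {K G : Type*} [NormedAddCommGroup K] [InnerProductSpace ℝ K] [CompleteSpace K]
  [NormedAddCommGroup G] [InnerProductSpace ℝ G] [CompleteSpace G]

theorem existsUnique_isBlockTriangularPrimalDual {B : K → Set K} {D : G → Set G}
    (hB : IsMaximallyMonotone B) (hD : IsMaximallyMonotone D) (E F : K → K) (V : K →L[ℝ] G)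
    {τ σ : ℝ} (hτ : 0 < τ) (hσ : 0 < σ) (lamInit : ℝ) (lam : ℕ → ℝ) (yInit y₀ : K) (z₀ : G) :
    ∃! s : (ℕ → K) × (ℕ → G),
      IsBlockTriangularPrimalDual B D E F V τ σ lamInit lam yInit y₀ z₀ s.1 s.2 := by
  choose J hJ using fun x => hB.nonempty_opResolvent hτ x
  choose J' hJ' using fun x => hD.opInverse.nonempty_opResolvent hσ x
  -- The state is (y_{k-1}, y_k, z_k), which makes the two-step recursion one-step.
  let x : ℕ → K × K × G := fun n => Nat.rec (yInit, y₀, z₀) (fun k s =>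
    let b := J (s.2.1 - τ • V.adjoint s.2.2 - τ • ((2 : ℝ) • E s.2.1 - E s.1) - τ • F s.2.1)
    (s.2.1, b, J' (s.2.2 + σ • V (s.2.1 + (lam k • (b - s.2.1)
      + (2 - lagged lamInit lam k) • (s.2.1 - s.1)))))) n
  have hlag : ∀ k, lagged yInit (fun n => (x n).2.1) k = (x k).1 := by
    rintro (_ | k) <;> rfl
  refine ⟨(fun n => (x n).2.1, fun n => (x n).2.2), ⟨rfl, rfl, fun k => ?_, fun k => ?_⟩, ?_⟩
  · rw [hlag]
    exact hJ _
  · rw [hlag]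
    exact hJ' _
  · rintro ⟨y, z⟩ h
    have key : ∀ k, lagged yInit y k = (x k).1 ∧ y k = (x k).2.1 ∧ z k = (x k).2.2 := by
      intro k
      induction k with
      | zero => exact ⟨rfl, h.y_zero, h.z_zero⟩
      | succ k ih =>
        obtain ⟨h1, h2, h3⟩ := ih
        have hy := h.y_succ k
        have hz := h.z_succ k
        simp only [h1, h2, h3] at hy hz
        have e1 : y (k + 1) = (x (k + 1)).2.1 := hB.1.eq_of_mem_opResolvent hτ hy (hJ _)
        rw [e1] at hz
        exact ⟨h2, e1, hD.opInverse.1.eq_of_mem_opResolvent hσ hz (hJ' _)⟩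
    exact Prod.ext (funext fun k => (key k).2.1) (funext fun k => (key k).2.2)

/-- Starting from the second update, the lagged values are genuine iterates, so y_{-1} and λ_{-1},
on which the step-size condition says nothing, do not enter. -/
theorem IsBlockTriangularPrimalDual.primal_mem {B : K → Set K} {D : G → Set G} {E F : K → K}
    {V : K →L[ℝ] G} {τ σ lamInit : ℝ} {lam : ℕ → ℝ} {yInit y₀ : K} {z₀ : G} {y : ℕ → K}
    {z : ℕ → G} (h : IsBlockTriangularPrimalDual B D E F V τ σ lamInit lam yInit y₀ z₀ y z)
    (hτ : 0 < τ) (n : ℕ) :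
    τ⁻¹ • (y (n + 1) - y (n + 2)) - V.adjoint (z (n + 1))
      - ((2 : ℝ) • E (y (n + 1)) - E (y n)) - F (y (n + 1)) ∈ B (y (n + 2)) := by
  have h1 := (mem_opResolvent_iff hτ.ne').1 (h.y_succ (n + 1))
  convert h1 using 1
  simp only [lagged, smul_sub, smul_smul, ← mul_assoc, inv_mul_cancel₀ hτ.ne', one_smul, one_mul]
  abel

theorem IsBlockTriangularPrimalDual.dual_mem {B : K → Set K} {D : G → Set G} {E F : K → K}
    {V : K →L[ℝ] G} {τ σ lamInit : ℝ} {lam : ℕ → ℝ} {yInit y₀ : K} {z₀ : G} {y : ℕ → K}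
    {z : ℕ → G} (h : IsBlockTriangularPrimalDual B D E F V τ σ lamInit lam yInit y₀ z₀ y z)
    (hσ : 0 < σ) (n : ℕ) :
    -- λ is written as 2 - (2 - λ) to match μ = 2 - λ in the energy inequality.
    σ⁻¹ • (z (n + 1) - z (n + 2)) + V (y (n + 1) + ((2 - (2 - lam (n + 1))) •
      (y (n + 2) - y (n + 1)) + (2 - lam n) • (y (n + 1) - y n))) ∈ opInverse D (z (n + 2)) := by
  have h1 := (mem_opResolvent_iff hσ.ne').1 (h.z_succ (n + 1))
  convert h1 using 1
  rw [sub_sub_cancel, add_sub_right_comm, smul_add, smul_smul, inv_mul_cancel₀ hσ.ne', one_smul]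
  rfl

/-- F enters only through monotonicity, Lipschitz continuity and the three-point bound, so the case
F = 0, β = 0 is covered as well. -/
theorem IsBlockTriangularPrimalDual.exists_weak_limit {B : K → Set K} {D : G → Set G}
    {E F : K → K} {V : K →L[ℝ] G} {τ σ lamInit β ε : ℝ} {δ βL : ℝ≥0} {lam : ℕ → ℝ} {yInit y₀ : K}
    {z₀ : G} {y : ℕ → K} {z : ℕ → G}
    (h : IsBlockTriangularPrimalDual B D E F V τ σ lamInit lam yInit y₀ z₀ y z)
    (hB : IsMaximallyMonotone B) (hD : IsMaximallyMonotone D)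
    (hE : IsMonotoneOperator (fun y => {E y})) (hE_lip : LipschitzWith δ E)
    (hF : IsMonotoneOperator (fun y => {F y})) (hF_lip : LipschitzWith βL F) (hβ : 0 ≤ β)
    (hF_le : ∀ x y s, -(β / 4 * ‖y - x‖ ^ 2) ≤ inner ℝ (F x - F s) (y - s))
    (h_sol : ∃ s t, IsPrimalDualSolution B D E F V s t) (hτ : 0 < τ) (hσ : 0 < σ) (hε : 0 < ε)
    (hstep : ∀ k, τ * σ * ‖V‖ ^ 2 + (|2 - lam k| + |2 - lam (k + 1)|) * √(τ * σ) * ‖V‖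
      + τ * (2 * (δ : ℝ) + 1 / 2 * β) ≤ 1 - ε) :
    ∃ p q, IsPrimalDualSolution B D E F V p q ∧ WeaklyConverges y p ∧ WeaklyConverges z q := by
  have hδ : (0 : ℝ) ≤ δ := δ.2
  have hasym := fun s t (hst : IsPrimalDualSolution B D E F V s t) => by
    have hst' := isPrimalDualSolution_iff.1 hst
    refine asymptotics_of_momentumEnergy_le V hτ hσ hδ hβ hε
      (μ := fun n => 2 - lam n) hstep (y := y) (z := z) (s := s) (t := t)
      (e := fun n => E (y (n + 1)) - E (y n)) (fun n => ?_) (fun n => ?_)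
    · simpa only [dist_eq_norm] using hE_lip.dist_le_mul (y (n + 1)) (y n)
    · refine momentumEnergy_succ_le V (es := E s) (f₁ := F (y (n + 1))) (fs := F s) ?_ ?_
        (hE _ _ _ _ rfl rfl) (hF_le _ _ _)
      · have := hB.1 _ _ _ _ (h.primal_mem hτ n) hst'.1
        rwa [show -(V.adjoint t + E s + F s) = -V.adjoint t - E s - F s by abel] at this
      · exact hD.1.opInverse _ _ _ _ (h.dual_mem hσ n) hst'.2
  obtain ⟨s, t, hst⟩ := h_sol
  obtain ⟨⟨R, hR⟩, hy0, hz0, -⟩ := hasym s t hst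
  have hy1 := (tendsto_add_atTop_iff_nat 1).2 hy0
  have hz1 := (tendsto_add_atTop_iff_nat 1).2 hz0
  obtain ⟨L, hL⟩ := exists_lipschitzWith_primalDualMap V hE_lip hF_lip
  have hV : τ * σ * ‖V‖ ^ 2 < 1 := by
    have h1 : 0 ≤ (|2 - lam 0| + |2 - lam 1|) * √(τ * σ) * ‖V‖ := by positivity
    have h2 : 0 ≤ τ * (2 * (δ : ℝ) + 1 / 2 * β) := by positivity
    linarith [hstep 0]
  have hlip0 : ∀ {T : K → K} {c : ℝ≥0}, LipschitzWith c T →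
      Tendsto (fun n => T (y (n + 1)) - T (y n)) atTop (𝓝 0) := by
    intro T c hT
    have hn : Tendsto (fun n => c * ‖y (n + 1) - y n‖) atTop (𝓝 0) := by
      simpa using hy0.norm.const_mul (c : ℝ)
    refine squeeze_zero_norm (fun n => ?_) hn
    simpa only [dist_eq_norm] using hT.dist_le_mul (y (n + 1)) (y n)
  have hμ0 : Tendsto (fun n => V ((2 - lam n) • (y (n + 1) - y n))) atTop (𝓝 0) := by
    have hn : Tendsto (fun n => (√(τ * σ))⁻¹ * ‖y (n + 1) - y n‖) atTop (𝓝 0) := by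
      simpa using hy0.norm.const_mul (√(τ * σ))⁻¹
    refine squeeze_zero_norm (fun n => ?_) hn
    have hs : 0 < √(τ * σ) := Real.sqrt_pos.2 (by positivity)
    have h3 : |2 - lam n| * ‖V‖ ≤ (√(τ * σ))⁻¹ := by
      rw [← one_div, le_div_iff₀ hs]
      have h1 : 0 ≤ |2 - lam (n + 1)| * √(τ * σ) * ‖V‖ := by positivity
      have h2 : 0 ≤ τ * (2 * (δ : ℝ) + 1 / 2 * β) := by positivity
      have h4 : 0 ≤ τ * σ * ‖V‖ ^ 2 := by positivity
      linarith [hstep n]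
    rw [map_smul, norm_smul, Real.norm_eq_abs]
    calc |2 - lam n| * ‖V (y (n + 1) - y n)‖ ≤ |2 - lam n| * (‖V‖ * ‖y (n + 1) - y n‖) := by
          gcongr
          exact V.le_opNorm _
      _ = |2 - lam n| * ‖V‖ * ‖y (n + 1) - y n‖ := by ring
      _ ≤ _ := by gcongr
  obtain ⟨p, q, hpq, hp, hq⟩ := exists_weak_limit_of_primalDualForm hτ hσ hV
    (y := fun n => y (n + 2)) (z := fun n => z (n + 2)) (S := IsPrimalDualSolution B D E F V)
    (fun n => (hR (n + 1)).1) (fun n => (hR (n + 1)).2)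
    (fun s t hst => by
      obtain ⟨-, -, -, ℓ, hℓ⟩ := hasym s t hst
      exact ⟨ℓ, (tendsto_add_atTop_iff_nat 1).2 hℓ⟩)
    (fun U p q hU hp hq => by
      have := hB.neg_mem_and_neg_mem_of_tendsto hD.opInverse hL
        (primalDualMap_monotone V hE hF) (l := U)
        (Eventually.of_forall fun n => (hR (n + 1)).1)
        (Eventually.of_forall fun n => (hR (n + 1)).2) hp hq
        (h.primal_mem hτ) (h.dual_mem hσ) (Tendsto.mono_left ?_ hU) (Tendsto.mono_left ?_ hU)
      · rw [isPrimalDualSolution_iff]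
        simpa [primalDualMap, opInverse] using this
      -- The residual is a sum of increments: the reflected term yields (E y_{n+2} - E y_{n+1}) - (E
      -- y_{n+1} - E y_n).
      · have := ((((hy1.const_smul (-τ⁻¹)).add ((V.adjoint.continuous.tendsto 0).comp hz1)).add
          ((tendsto_add_atTop_iff_nat 1).2 (hlip0 hE_lip))).sub (hlip0 hE_lip)).add
          ((tendsto_add_atTop_iff_nat 1).2 (hlip0 hF_lip))
        simp only [smul_zero, map_zero, add_zero, sub_zero] at this
        refine this.congr fun n => ?_
        simp only [primalDualMap, Function.comp_apply, map_sub, two_smul, neg_smul, smul_sub]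
        abel
      · have := (((hz1.const_smul (-σ⁻¹)).add ((V.continuous.tendsto 0).comp hy1)).sub
          ((tendsto_add_atTop_iff_nat 1).2 hμ0)).add hμ0
        simp only [smul_zero, map_zero, add_zero, sub_zero] at this
        refine this.congr fun n => ?_
        simp only [primalDualMap, Function.comp_apply, map_sub, map_add, map_smul]
        module)
  refine ⟨p, q, hpq, weaklyConverges_iff.2 fun v => ?_, weaklyConverges_iff.2 fun v => ?_⟩
  · exact (tendsto_add_atTop_iff_nat 2).1 (weaklyConverges_iff.1 hp v)
  · exact (tendsto_add_atTop_iff_nat 2).1 (weaklyConverges_iff.1 hq v)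

end Main

theorem corollary6p2 {K G : Type*}
    [NormedAddCommGroup K] [InnerProductSpace ℝ K] [CompleteSpace K]
    [NormedAddCommGroup G] [InnerProductSpace ℝ G] [CompleteSpace G]
    (B : K → Set K) (D : G → Set G) (E F : K → K) (V : K →L[ℝ] G)
    (δ : ℝ≥0) (β : ℝ)
    (hB : IsMaximallyMonotone B) (hD : IsMaximallyMonotone D)
    (hE : IsMonotoneOperator (fun y => {E y})) (hE_lip : LipschitzWith δ E)
    (hF : IsCocoerciveInv β F ∨ (F = 0 ∧ β = 0))
    (h_sol : ∃ y : K, IsPrimalSolution B D E F V y)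
    (τ σ : ℝ) (hτ : 0 < τ) (hσ : 0 < σ)
    (lamInit : ℝ) (lam : ℕ → ℝ) (yInit y₀ : K) (z₀ : G)
    (h_step : ∃ ε : ℝ, 0 < ε ∧ ∀ k : ℕ,
      τ * σ * ‖V‖ ^ 2
        + (|2 - lam k| + |2 - lam (k + 1)|) * Real.sqrt (τ * σ) * ‖V‖
        + τ * (2 * (δ : ℝ) + 1 / 2 * β) < 1 - ε) :
    (∃! s : (ℕ → K) × (ℕ → G),
      IsBlockTriangularPrimalDual B D E F V τ σ lamInit lam yInit y₀ z₀ s.1 s.2) ∧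
    ∀ (y : ℕ → K) (z : ℕ → G),
      IsBlockTriangularPrimalDual B D E F V τ σ lamInit lam yInit y₀ z₀ y z →
      ∃ (yStar : K) (zStar : G),
        WeaklyConverges y yStar ∧ WeaklyConverges z zStar ∧
        IsPrimalSolution B D E F V yStar ∧
        IsPrimalDualSolution B D E F V yStar zStar := by
  refine ⟨existsUnique_isBlockTriangularPrimalDual hB hD E F V hτ hσ lamInit lam yInit y₀ z₀,
    fun y z h => ?_⟩
  obtain ⟨ε, hε, hstep⟩ := h_step
  obtain ⟨s, hs⟩ := h_sol
  obtain ⟨t, hst⟩ := isPrimalSolution_iff.1 hs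
  have hF' : 0 ≤ β ∧ IsMonotoneOperator (fun y => {F y}) ∧ (∃ βL, LipschitzWith βL F) ∧
      ∀ x y s, -(β / 4 * ‖y - x‖ ^ 2) ≤ inner ℝ (F x - F s) (y - s) := by
    rcases hF with hF | ⟨rfl, rfl⟩
    · exact ⟨hF.1.le, hF.isMonotoneOperator, ⟨_, hF.lipschitzWith⟩, hF.neg_le_inner⟩
    · refine ⟨le_rfl, ?_, ⟨0, LipschitzWith.const 0⟩, by simp⟩
      rintro x y _ _ rfl rfl
      simp
  obtain ⟨hβ, hFm, ⟨βL, hFl⟩, hFle⟩ := hF'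
  obtain ⟨p, q, hpq, hp, hq⟩ := h.exists_weak_limit hB hD hE hE_lip hFm hFl hβ hFle ⟨s, t, hst⟩
    hτ hσ hε fun k => (hstep k).le
  exact ⟨p, q, hp, hq, isPrimalSolution_iff.2 ⟨q, hpq⟩, hpq⟩
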